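/- For positive integers $i,j,n$ let $d_{i,j}(n)$ be the number of pairs $(a,b)$ of positive integers with $a^ib^j\mid n$, and for real $x\ge 1$, $h>0$, $D>0$ put $$S_{i,j}(x,h,D)=\sum_{x<n\le x+h}\exp\bigl(-D\,d_{i,j}(n)\bigr),$$ the sum being over integers $n$. Let $0<\beta<\tfrac12$ and $D>0$. If $h(x)\gg x^{\beta}$, then $S_{i,j}(x,h(x),D)\gg h(x)$ for all integers $i,j\ge 2$, with an implied constant depending only on $\beta$ and $D$, in the following precise sense. (1) There is a constant $c>0$, depending only on $\beta$ and $D$, such that for every $B>0$ there is $X\ge 1$, depending only on $\beta$, $D$ and $B$, with the following property: for all integers $i,j\ge2$ and every function $h:[1,\infty)\to\mathbb{R}$ with $h(x)\ge Bx^{\beta}$ for all $x\ge1$, $$S_{i,j}(x,h(x),D)\ge c\,h(x)\qquad\text{for all real }x\ge X.$$ (2) For every $B>0$ there is a constant $c>0$, depending only on $\beta$, $D$ and $B$, such that for all integers $i,j\ge2$ and every function $h:[1,\infty)\to\mathbb{R}$ with $h(x)\ge\max(1,Bx^{\beta})$ for all $x\ge1$, $$S_{i,j}(x,h(x),D)\ge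 c\,h(x)\qquad\text{for all real }x\ge 1.$$ -/

import Mathlib

/-- `d_{i,j}(n)`: the number of pairs `(a, b)` of positive integers with `a ^ i * b ^ j ∣ n`
(a finite number when `i, j, n ≥ 1`). -/
noncomputable def powerPairCount (i j n : ℕ) : ℕ :=
  Set.ncard {p : ℕ × ℕ | 0 < p.1 ∧ 0 < p.2 ∧ p.1 ^ i * p.2 ^ j ∣ n}

/-- `S_{i,j}(x, h, D)`: the sum of `exp (-D * d_{i,j}(n))` over the integers `n` with
`x < n ≤ x + h` (for real `x, h ≥ 0`). -/
noncomputable def shortExpSum (i j : ℕ) (x h D : ℝ) : ℝ :=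
  ∑ n ∈ Finset.Ioc ⌊x⌋₊ ⌊x + h⌋₊, Real.exp (-D * (powerPairCount i j n : ℝ))

/-! Put `y = ⌊√h⌋` and discard every `n` in `(x, x + h]` divisible by some `d ^ 2` with `2 ≤ d ≤ y`.
Since `∑ 1 / d ^ 2 ≤ 3 / 4 < 1`, at least about `h / 4 - √h` integers survive
(`card_filter_no_sq_dvd_ge`). Write a survivor as `m ^ 2 * s` with `s` squarefree: the primes of `m`
exceed `y`, and `n < (y + 1) ^ k` with `k` depending only on `β`, so `m` has at most `2 ^ k`
divisors. As `i, j ≥ 2`, both `a` and `b` divide `m`, so `d_{i,j}(n) ≤ 4 ^ k`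
(`powerPairCount_le_four_pow`) and a positive proportion of terms is at least `exp (-D * 4 ^ k)`. -/

theorem card_divisors_le_two_pow (q k : ℕ) :
    ∀ m : ℕ, m ≠ 0 → (∀ p : ℕ, p.Prime → p ∣ m → q ≤ p) → m < q ^ k →
      m.divisors.card ≤ 2 ^ k := by
  induction k with
  | zero => intro m hm _ hlt; simp at hlt; omega
  | succ k ih =>
    intro m hm hp hlt
    by_cases h1 : m = 1
    · subst h1; simpa using Nat.one_le_two_pow
    obtain ⟨p, pp, m', rfl⟩ := Nat.exists_prime_and_dvd h1
    have hm' : m' ≠ 0 := by rintro rfl; simp at hm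
    have hqp : q ≤ p := hp p pp (dvd_mul_right _ _)
    have hlt' : m' < q ^ k := by
      by_contra hcon
      have := Nat.mul_le_mul hqp (not_lt.1 hcon)
      rw [pow_succ'] at hlt
      omega
    have h2 := ih m' hm' (fun r hr hd => hp r hr (hd.mul_left p)) hlt'
    calc (p * m').divisors.card ≤ p.divisors.card * m'.divisors.card := by
          rw [Nat.divisors_mul]; exact Finset.card_mul_le
      _ ≤ 2 * 2 ^ k := by
          refine Nat.mul_le_mul ?_ h2
          rw [pp.divisors]; exact Finset.card_le_two
      _ = 2 ^ (k + 1) := (pow_succ' 2 k).symm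

/-- Parity at each prime: `2 v(a) ≤ 2 v(m) + 1` forces `v(a) ≤ v(m)`. -/
theorem dvd_of_sq_dvd_sq_mul_squarefree {a m s : ℕ} (hs : Squarefree s) (h : a ^ 2 ∣ m ^ 2 * s) :
    a ∣ m := by
  rcases eq_or_ne m 0 with rfl | hm
  · exact dvd_zero a
  have hs0 : s ≠ 0 := hs.ne_zero
  have hprod : m ^ 2 * s ≠ 0 := mul_ne_zero (pow_ne_zero 2 hm) hs0
  have ha : a ≠ 0 := by rintro rfl; exact hprod (by simpa using h)
  rw [← Nat.factorization_le_iff_dvd ha hm]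
  intro p
  have h1 := (Nat.factorization_le_iff_dvd (pow_ne_zero 2 ha) hprod).2 h p
  rw [Nat.factorization_mul (pow_ne_zero 2 hm) hs0] at h1
  simp only [Nat.factorization_pow, Finsupp.add_apply, Finsupp.smul_apply, smul_eq_mul] at h1
  have h2 := hs.natFactorization_le_one p
  omega

theorem powerPairCount_le_of_sq_dvd {i j n : ℕ} (hi : 2 ≤ i) (hj : 2 ≤ j) (S : Finset ℕ)
    (hS : ∀ a : ℕ, a ^ 2 ∣ n → a ∈ S) : powerPairCount i j n ≤ S.card ^ 2 := by
  unfold powerPairCount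
  have hsub : {p : ℕ × ℕ | 0 < p.1 ∧ 0 < p.2 ∧ p.1 ^ i * p.2 ^ j ∣ n} ⊆ ↑(S ×ˢ S) := by
    rintro ⟨a, b⟩ ⟨_, _, h⟩
    simp only [Finset.coe_product, Set.mem_prod, Finset.mem_coe]
    exact ⟨hS a (((pow_dvd_pow a hi).trans (dvd_mul_right _ _)).trans h),
      hS b (((pow_dvd_pow b hj).trans (dvd_mul_left _ _)).trans h)⟩
  calc _ ≤ Set.ncard (↑(S ×ˢ S) : Set (ℕ × ℕ)) := Set.ncard_le_ncard hsub (Finset.finite_toSet _)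
    _ = S.card ^ 2 := by rw [Set.ncard_coe_finset, Finset.card_product, sq]

theorem powerPairCount_le_sq {i j n : ℕ} (hi : 2 ≤ i) (hj : 2 ≤ j) (hn : n ≠ 0) :
    powerPairCount i j n ≤ n ^ 2 :=
  (powerPairCount_le_of_sq_dvd hi hj n.divisors fun a ha =>
    Nat.mem_divisors.2 ⟨(dvd_pow_self a two_ne_zero).trans ha, hn⟩).trans
    (Nat.pow_le_pow_left (Nat.card_divisors_le_self n) 2)

theorem powerPairCount_le_four_pow {i j n y k : ℕ} (hi : 2 ≤ i) (hj : 2 ≤ j) (hn : n ≠ 0)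
    (hfree : ∀ d ∈ Finset.Icc 2 y, ¬ d ^ 2 ∣ n) (hlt : n < (y + 1) ^ k) :
    powerPairCount i j n ≤ 4 ^ k := by
  obtain ⟨s, m, hsm, hs⟩ := Nat.sq_mul_squarefree n
  have hm : m ≠ 0 := by rintro rfl; exact hn (by simpa using hsm.symm)
  have hmn : m ∣ n := hsm ▸ (dvd_pow_self m two_ne_zero).mul_right s
  have hcard : m.divisors.card ≤ 2 ^ k := by
    refine card_divisors_le_two_pow (y + 1) k m hm (fun p pp hpm => ?_)
      ((Nat.le_of_dvd (Nat.pos_of_ne_zero hn) hmn).trans_lt hlt)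
    by_contra hcon
    exact hfree p (Finset.mem_Icc.2 ⟨pp.two_le, by omega⟩)
      (hsm ▸ (pow_dvd_pow_of_dvd hpm 2).mul_right s)
  refine (powerPairCount_le_of_sq_dvd hi hj m.divisors fun a ha => ?_).trans
    ((Nat.pow_le_pow_left hcard 2).trans_eq ?_)
  · exact Nat.mem_divisors.2 ⟨dvd_of_sq_dvd_sq_mul_squarefree hs (hsm ▸ ha), hm⟩
  · rw [← pow_mul, mul_comm, pow_mul]; norm_num

theorem card_filter_dvd_Ioc_le (a b r : ℕ) (hab : a ≤ b) (hr : 0 < r) :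
    (((Finset.Ioc a b).filter (r ∣ ·)).card : ℝ) ≤ ((b : ℝ) - a) / r + 1 := by
  have hr' : (0 : ℝ) < r := by exact_mod_cast hr
  have hsplit : ((Finset.Ioc a b).filter (r ∣ ·)).card + a / r ≤ b / r := by
    rw [← Nat.Ioc_filter_dvd_card_eq_div a r, ← Nat.Ioc_filter_dvd_card_eq_div b r,
      ← Finset.card_union_of_disjoint]
    · refine Finset.card_le_card fun n hn => ?_
      simp only [Finset.mem_union, Finset.mem_filter, Finset.mem_Ioc] at hn ⊢
      rcases hn with ⟨⟨h1, h2⟩, h3⟩ | ⟨⟨h1, h2⟩, h3⟩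
      · exact ⟨⟨by omega, h2⟩, h3⟩
      · exact ⟨⟨h1, by omega⟩, h3⟩
    · rw [Finset.disjoint_left]
      intro n hn hn'
      simp only [Finset.mem_filter, Finset.mem_Ioc] at hn hn'
      omega
  have h1 : (((Finset.Ioc a b).filter (r ∣ ·)).card : ℝ) + ((a / r : ℕ) : ℝ) ≤ ((b / r : ℕ) : ℝ) := by
    exact_mod_cast hsplit
  have h2 : ((b / r : ℕ) : ℝ) ≤ (b : ℝ) / r := Nat.cast_div_le
  have h3 : (a : ℝ) / r ≤ ((a / r : ℕ) : ℝ) + 1 := by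
    rw [div_le_iff₀ hr']
    have : a ≤ (a / r + 1) * r := by
      have := Nat.lt_div_mul_add (a := a) hr
      rw [add_mul]; omega
    exact_mod_cast this
  rw [sub_div]
  linarith

theorem sum_Icc_two_inv_sq_le (y : ℕ) :
    ∑ d ∈ Finset.Icc 2 y, (1 : ℝ) / ((d ^ 2 : ℕ) : ℝ) ≤ 3 / 4 := by
  -- Telescoping with `1 / d ^ 2 ≤ 1 / (d - 1) - 1 / d` from `d = 3` on; equality at `y = 0`.
  have key : ∀ y : ℕ, ∑ d ∈ Finset.Icc 2 (y + 2), (1 : ℝ) / ((d ^ 2 : ℕ) : ℝ)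
      ≤ 3 / 4 - 1 / ((y : ℝ) + 2) := by
    intro y
    induction y with
    | zero => norm_num
    | succ y ih =>
      rw [show y + 1 + 2 = (y + 2) + 1 by ring, Finset.sum_Icc_succ_top (by omega)]
      have : (1 : ℝ) / (((y + 2 + 1) ^ 2 : ℕ) : ℝ) ≤ 1 / ((y : ℝ) + 2) - 1 / ((y : ℝ) + 3) := by
        rw [div_sub_div _ _ (by positivity) (by positivity),
          div_le_div_iff₀ (by positivity) (by positivity)]
        push_cast
        nlinarith [(Nat.cast_nonneg y : (0 : ℝ) ≤ y)]
      push_cast at this ih ⊢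
      rw [show (y : ℝ) + 1 + 2 = y + 3 by ring]
      linarith
  refine (Finset.sum_le_sum_of_subset_of_nonneg
    (Finset.Icc_subset_Icc_right (Nat.le_add_right y 2)) fun _ _ _ => by positivity).trans
    ((key y).trans ?_)
  have : (0 : ℝ) ≤ 1 / ((y : ℝ) + 2) := by positivity
  linarith

theorem card_filter_no_sq_dvd_ge (a b y : ℕ) (hab : a ≤ b) :
    ((b : ℝ) - a) / 4 - y ≤
      (((Finset.Ioc a b).filter fun n => ∀ d ∈ Finset.Icc 2 y, ¬ d ^ 2 ∣ n).card : ℝ) := by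
  have hba : (0 : ℝ) ≤ (b : ℝ) - a := sub_nonneg.2 (by exact_mod_cast hab)
  have hbad : (((Finset.Ioc a b).filter fun n => ¬ ∀ d ∈ Finset.Icc 2 y, ¬ d ^ 2 ∣ n).card : ℝ)
      ≤ 3 / 4 * ((b : ℝ) - a) + y := by
    have hsub : ((Finset.Ioc a b).filter fun n => ¬ ∀ d ∈ Finset.Icc 2 y, ¬ d ^ 2 ∣ n) ⊆
        (Finset.Icc 2 y).biUnion fun d => (Finset.Ioc a b).filter (d ^ 2 ∣ ·) := by
      intro n hn
      simp only [Finset.mem_filter, not_forall, not_not] at hn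
      obtain ⟨hn, d, hd, hdn⟩ := hn
      exact Finset.mem_biUnion.2 ⟨d, hd, Finset.mem_filter.2 ⟨hn, hdn⟩⟩
    calc (((Finset.Ioc a b).filter fun n => ¬ ∀ d ∈ Finset.Icc 2 y, ¬ d ^ 2 ∣ n).card : ℝ)
        ≤ ∑ d ∈ Finset.Icc 2 y, (((Finset.Ioc a b).filter (d ^ 2 ∣ ·)).card : ℝ) := by
          exact_mod_cast (Finset.card_le_card hsub).trans Finset.card_biUnion_le
      _ ≤ ∑ d ∈ Finset.Icc 2 y, (((b : ℝ) - a) * (1 / ((d ^ 2 : ℕ) : ℝ)) + 1) := by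
          refine Finset.sum_le_sum fun d hd => ?_
          rw [mul_one_div]
          exact card_filter_dvd_Ioc_le a b (d ^ 2) hab
            (pow_pos (by have := (Finset.mem_Icc.1 hd).1; omega) 2)
      _ = ((b : ℝ) - a) * ∑ d ∈ Finset.Icc 2 y, (1 / ((d ^ 2 : ℕ) : ℝ))
            + (Finset.Icc 2 y).card := by
          rw [Finset.sum_add_distrib, Finset.mul_sum]; simp
      _ ≤ ((b : ℝ) - a) * (3 / 4) + y := by
          refine add_le_add (mul_le_mul_of_nonneg_left (sum_Icc_two_inv_sq_le y) hba) ?_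
          rw [Nat.card_Icc]
          exact_mod_cast (by omega : y + 1 - 2 ≤ y)
      _ = _ := by ring
  have htot := Finset.card_filter_add_card_filter_not (s := Finset.Ioc a b)
    (fun n => ∀ d ∈ Finset.Icc 2 y, ¬ d ^ 2 ∣ n)
  rw [Nat.card_Ioc] at htot
  have htot' := congrArg (Nat.cast : ℕ → ℝ) htot
  rw [Nat.cast_sub hab, Nat.cast_add] at htot'
  linarith

theorem shortExpSum_ge_of_lt_pow {i j k : ℕ} {x h D : ℝ} (hi : 2 ≤ i) (hj : 2 ≤ j) (hx : 1 ≤ x)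
    (hh : 144 ≤ h) (hD : 0 < D) (hk : x + h ≤ √h ^ k) :
    Real.exp (-D * 4 ^ k) / 8 * h ≤ shortExpSum i j x h D := by
  set a := ⌊x⌋₊
  set b := ⌊x + h⌋₊
  set y := ⌊√h⌋₊
  have hab : a ≤ b := Nat.floor_mono (by linarith)
  have hb : (b : ℝ) ≤ x + h := Nat.floor_le (by linarith)
  have hb' : x + h < b + 1 := Nat.lt_floor_add_one _
  have ha : (a : ℝ) ≤ x := Nat.floor_le (by linarith)
  have hy : (y : ℝ) ≤ √h := Nat.floor_le (Real.sqrt_nonneg h)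
  have hy' : √h < (y : ℝ) + 1 := Nat.lt_floor_add_one _
  have hsq : √h * √h = h := Real.mul_self_sqrt (by linarith)
  have h12 : (12 : ℝ) ≤ √h := Real.le_sqrt_of_sq_le (by linarith)
  have hcount := card_filter_no_sq_dvd_ge a b y hab
  set G := (Finset.Ioc a b).filter fun n => ∀ d ∈ Finset.Icc 2 y, ¬ d ^ 2 ∣ n with hG
  -- `b - a > h - 1`, and `√h ≥ 12` makes `(h - 1) / 4 - √h ≥ h / 8`.
  have hGh : h / 8 ≤ (G.card : ℝ) := by nlinarith
  have hk0 : k ≠ 0 := by rintro rfl; simp at hk; linarith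
  have hterm : ∀ n ∈ G, Real.exp (-D * 4 ^ k) ≤ Real.exp (-D * (powerPairCount i j n : ℝ)) := by
    intro n hn
    obtain ⟨hn, hfree⟩ := Finset.mem_filter.1 hn
    obtain ⟨hn1, hn2⟩ := Finset.mem_Ioc.1 hn
    have hlt : n < (y + 1) ^ k := by
      have h1 : (n : ℝ) ≤ b := by exact_mod_cast hn2
      have h2 : √h ^ k < ((y : ℝ) + 1) ^ k := pow_lt_pow_left₀ hy' (Real.sqrt_nonneg h) hk0
      have h3 : (n : ℝ) < ((y : ℝ) + 1) ^ k := by linarith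
      exact_mod_cast h3
    have hle : (powerPairCount i j n : ℝ) ≤ 4 ^ k := by
      exact_mod_cast powerPairCount_le_four_pow hi hj (by omega) hfree hlt
    exact Real.exp_le_exp.2 (by nlinarith)
  calc Real.exp (-D * 4 ^ k) / 8 * h = h / 8 * Real.exp (-D * 4 ^ k) := by ring
    _ ≤ G.card * Real.exp (-D * 4 ^ k) := mul_le_mul_of_nonneg_right hGh (Real.exp_pos _).le
    _ = ∑ _n ∈ G, Real.exp (-D * 4 ^ k) := by rw [Finset.sum_const, nsmul_eq_mul]
    _ ≤ ∑ n ∈ G, Real.exp (-D * (powerPairCount i j n : ℝ)) := Finset.sum_le_sum hterm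
    _ ≤ shortExpSum i j x h D :=
      Finset.sum_le_sum_of_subset_of_nonneg (Finset.filter_subset _ _)
        fun _ _ _ => (Real.exp_pos _).le

theorem le_div_rpow_inv {β B x h : ℝ} (hβ : 0 < β) (hB : 0 < B) (hx : 0 ≤ x)
    (hxh : B * x ^ β ≤ h) : x ≤ (h / B) ^ β⁻¹ := by
  have h1 : x ^ β ≤ h / B := by rw [le_div_iff₀ hB]; linarith
  have h2 := Real.rpow_le_rpow (Real.rpow_nonneg hx β) h1 (inv_nonneg.2 hβ.le)
  rwa [Real.rpow_rpow_inv hx hβ.ne'] at h2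

theorem add_le_sqrt_pow {β B x h : ℝ} {k : ℕ} (hβ : 0 < β) (hB : 0 < B) (hx : 0 ≤ x) (hh : 2 ≤ h)
    (hhB : (1 / B) ^ β⁻¹ ≤ h) (hxh : B * x ^ β ≤ h) (hk : 2 * (β⁻¹ + 2) ≤ k) :
    x + h ≤ √h ^ k := by
  have hh0 : 0 < h := by linarith
  have hβ' : 0 < β⁻¹ := inv_pos.2 hβ
  -- One spare factor `h` absorbs `B`; a second, using `h ≥ 2`, absorbs the sum `x + h`. Hence the
  -- exponent `β⁻¹ + 2`.
  have hx1 : x ≤ h ^ (β⁻¹ + 1) := by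
    calc x ≤ (h / B) ^ β⁻¹ := le_div_rpow_inv hβ hB hx hxh
      _ = h ^ β⁻¹ * (1 / B) ^ β⁻¹ := by
        rw [← Real.mul_rpow hh0.le (by positivity), mul_one_div]
      _ ≤ h ^ β⁻¹ * h := mul_le_mul_of_nonneg_left hhB (by positivity)
      _ = h ^ (β⁻¹ + 1) := by rw [Real.rpow_add hh0, Real.rpow_one]
  have hh1 : h ≤ h ^ (β⁻¹ + 1) := by
    conv_lhs => rw [← Real.rpow_one h]
    exact Real.rpow_le_rpow_of_exponent_le (by linarith) (by linarith)
  calc x + h ≤ h ^ (β⁻¹ + 1) * h := by nlinarith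
    _ = h ^ (β⁻¹ + 2) := by
      rw [show β⁻¹ + 2 = (β⁻¹ + 1) + 1 by ring, Real.rpow_add hh0 (β⁻¹ + 1), Real.rpow_one]
    _ ≤ h ^ ((1 / 2 : ℝ) * k) := Real.rpow_le_rpow_of_exponent_le (by linarith) (by linarith)
    _ = √h ^ k := by rw [Real.rpow_mul hh0.le, Real.rpow_natCast, Real.sqrt_eq_rpow]

/-- The bound holds as soon as `h` is large in terms of `β` and `B`, whatever the size of `x`. -/
theorem exists_shortExpSum_ge_of_large {β D : ℝ} (hβ : 0 < β) (hD : 0 < D) :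
    ∃ c : ℝ, 0 < c ∧ ∀ B : ℝ, 0 < B → ∃ H : ℝ, 1 ≤ H ∧ ∀ i j : ℕ, 2 ≤ i → 2 ≤ j →
      ∀ x h : ℝ, 1 ≤ x → H ≤ h → B * x ^ β ≤ h → c * h ≤ shortExpSum i j x h D := by
  -- `k` is chosen before `B`, so `c` is independent of `B`; only the threshold `H` sees it.
  obtain ⟨k, hk⟩ := exists_nat_ge (2 * (β⁻¹ + 2))
  refine ⟨Real.exp (-D * 4 ^ k) / 8, by positivity, fun B hB =>
    ⟨max 144 ((1 / B) ^ β⁻¹), le_trans (by norm_num) (le_max_left _ _), ?_⟩⟩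
  intro i j hi hj x h hx hh hxh
  have h144 : 144 ≤ h := (le_max_left _ _).trans hh
  exact shortExpSum_ge_of_lt_pow hi hj hx h144 hD
    (add_le_sqrt_pow hβ hB (by linarith) (by linarith) ((le_max_right _ _).trans hh) hxh hk)

/-- For bounded `x + h` a single term suffices: `h ≥ 1` puts `⌊x + h⌋` in the range. -/
theorem exp_le_shortExpSum_of_add_le {i j : ℕ} {x h D N : ℝ} (hi : 2 ≤ i) (hj : 2 ≤ j)
    (hx : 1 ≤ x) (hh : 1 ≤ h) (hD : 0 < D) (hN : x + h ≤ N) :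
    Real.exp (-D * N ^ 2) ≤ shortExpSum i j x h D := by
  have hb : (⌊x + h⌋₊ : ℝ) ≤ x + h := Nat.floor_le (by linarith)
  have hlt : ⌊x⌋₊ < ⌊x + h⌋₊ := by
    have : ⌊x + 1⌋₊ ≤ ⌊x + h⌋₊ := Nat.floor_mono (by linarith)
    rw [Nat.floor_add_one (by linarith)] at this
    omega
  have hcount : (powerPairCount i j ⌊x + h⌋₊ : ℝ) ≤ N ^ 2 := by
    have h1 : (powerPairCount i j ⌊x + h⌋₊ : ℝ) ≤ (⌊x + h⌋₊ : ℝ) ^ 2 := by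
      exact_mod_cast powerPairCount_le_sq hi hj (by omega)
    exact h1.trans (pow_le_pow_left₀ (Nat.cast_nonneg _) (hb.trans hN) 2)
  refine (Real.exp_le_exp.2 (by nlinarith)).trans (Finset.single_le_sum
    (f := fun n : ℕ => Real.exp (-D * (powerPairCount i j n : ℝ)))
    (fun _ _ => (Real.exp_pos _).le) (Finset.mem_Ioc.2 ⟨hlt, le_rfl⟩))

theorem mainTheorem5 (β D : ℝ) (hβ_pos : 0 < β) (hβ_lt : β < 1 / 2) (hD : 0 < D) :
    (∃ c : ℝ, 0 < c ∧ ∀ B : ℝ, 0 < B → ∃ X : ℝ, 1 ≤ X ∧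
      ∀ i j : ℕ, 2 ≤ i → 2 ≤ j → ∀ h : ℝ → ℝ, (∀ x : ℝ, 1 ≤ x → B * x ^ β ≤ h x) →
        ∀ x : ℝ, X ≤ x → c * h x ≤ shortExpSum i j x (h x) D) ∧
    (∀ B : ℝ, 0 < B → ∃ c : ℝ, 0 < c ∧
      ∀ i j : ℕ, 2 ≤ i → 2 ≤ j → ∀ h : ℝ → ℝ,
        (∀ x : ℝ, 1 ≤ x → 1 ≤ h x ∧ B * x ^ β ≤ h x) →
        ∀ x : ℝ, 1 ≤ x → c * h x ≤ shortExpSum i j x (h x) D) := by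
  obtain ⟨c, hc, hlarge⟩ := exists_shortExpSum_ge_of_large hβ_pos hD
  refine ⟨⟨c, hc, fun B hB => ?_⟩, fun B hB => ?_⟩
  · obtain ⟨H, hH, hsum⟩ := hlarge B hB
    -- Beyond this point `B * x ^ β ≥ H`.
    refine ⟨max 1 ((H / B) ^ β⁻¹), le_max_left _ _, fun i j hi hj h hh x hx => ?_⟩
    have hx1 : 1 ≤ x := (le_max_left _ _).trans hx
    refine hsum i j hi hj x (h x) hx1 (le_trans ?_ (hh x hx1)) (hh x hx1)
    have h1 := Real.rpow_le_rpow (by positivity) ((le_max_right _ _).trans hx) hβ_pos.le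
    rw [Real.rpow_inv_rpow (by positivity) hβ_pos.ne', div_le_iff₀ hB] at h1
    linarith
  · obtain ⟨H, hH, hsum⟩ := hlarge B hB
    have hH0 : 0 < H := by linarith
    -- If `h x ≤ H`, then `B * x ^ β ≤ H` bounds `x` too, so `x + h x ≤ N`.
    set N := (H / B) ^ β⁻¹ + H with hN
    refine ⟨min c (Real.exp (-D * N ^ 2) / H), lt_min hc (by positivity),
      fun i j hi hj h hh x hx => ?_⟩
    obtain ⟨hh1, hhB⟩ := hh x hx
    have hh0 : 0 ≤ h x := by linarith
    rcases le_total H (h x) with hle | hle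
    · exact (mul_le_mul_of_nonneg_right (min_le_left _ _) hh0).trans
        (hsum i j hi hj x (h x) hx hle hhB)
    · have hxN : x + h x ≤ N :=
        add_le_add (le_div_rpow_inv hβ_pos hB (by linarith) (hhB.trans hle)) hle
      calc min c (Real.exp (-D * N ^ 2) / H) * h x
          ≤ Real.exp (-D * N ^ 2) / H * H :=
            mul_le_mul (min_le_right _ _) hle hh0 (by positivity)
        _ = Real.exp (-D * N ^ 2) := div_mul_cancel₀ _ hH0.ne'
        _ ≤ shortExpSum i j x (h x) D := exp_le_shortExpSum_of_add_le hi hj hx hh1 hD hxN
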